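/- **Setting.** Let $\Delta=\{(s,t)\in[0,1]^2: s\le t\}$, let $X_1,X_2,\dots$ be a sample on a probability space, and let $\mathcal F_1,\dots,\mathcal F_J$ be classes of real functions on the sample space with $\sup_{f\in\mathcal F_j}|f(z)|<\infty$ for all $z$ and $j$. For $(s,t)\in\Delta$ let $$\hat y_{n,s,t}=\Big(\Big(\frac{1}{\lfloor nt\rfloor-\lfloor ns\rfloor}\sum_{i=\lfloor ns\rfloor+1}^{\lfloor nt\rfloor}f(X_i)\Big)_{f\in\mathcal F_j}\Big)_{j=1,\dots,J}\in\ell^\infty(\mathcal F_1)\times\dots\times\ell^\infty(\mathcal F_J)\qquad(0/0:=0),$$ let $x\in\ell^\infty(\mathcal F_1)\times\dots\times\ell^\infty(\mathcal F_J)$ (maximum norm), let $\alpha_n\to\infty$ be real numbers, and let $\phi$ be a map from a subset $D_\phi$ of $\ell^\infty(\mathcal F_1)\times\dots\times\ell^\infty(\mathcal F_J)$ to $\mathbb R^p$. Put $$\mathbb Y_n(s,t)=(t-s)\alpha_n(\hat y_{n,s,t}-x),\qquad \mathbb V_n(s,t)=(t-s)\alpha_n\big(\phi(\hat y_{n,s,t})-\phi(x)\big)\in\mathbb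 R^p .$$ Let $H$ be a probability measure on $\Delta$ and let $K\subset\Delta$ be a compact set which contains $(0,1)$ and the support of $H$ (for example $K=\Delta$). Almost surely, $\hat y_{n,s,t}\in D_\phi$ for all $(s,t)\in K$ with $\lfloor ns\rfloor<\lfloor nt\rfloor$ (for an empty sub-sample, $\phi(0)$ is any fixed vector if $0\notin D_\phi$). Weak convergence $\rightsquigarrow$ is understood in the Hoffmann-Jørgensen sense: $E^*f(Z_n)\to Ef(Z)$ for all bounded continuous $f$, with a Borel measurable limit $Z$. **Assumptions.** * (C) $\phi$ is compactly (Hadamard) differentiable at $x\in D_\phi$ tangentially to a set $V$ with $0\in V$ and $cV\subset V$ for all $c>0$: there is a continuous linear $\phi_x'$ such that $r_n^{-1}(\phi(x+r_nh_n)-\phi(x))\to\phi_x'h$ whenever $r_n\downarrow0$, $h_n\to h\in V$ and $x+r_nh_n\in D_\phi$ for all $n$. * (W) $\mathbb Y_n\rightsquigarrow\mathbb Y$ in the space of bounded functions $\Delta\to\ell^\infty(\mathcal F_1)\times\dots\times\ell^\infty(\mathcal F_J)$ with the supremum norm, where $\mathbb Y$ is a centered, Borel measurable process. * (A1) $\sup\{\|\mathbb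 Y(s,t)-\mathbb Y(s',t')\|:(s,t),(s',t')\in K,\ |s-s'|+|t-t'|\le\delta\}=o_P(1)$ as $\delta\to0$. * (A2) Almost surely, $\mathbb Y(s,t)\in V$ for all $(s,t)\in K$. * (A3) For every sequence $k_n\to0$, $\sup\{\alpha_n(t-s)\|\phi(\hat y_{n,s,t})\|:(s,t)\in K,\ \alpha_n(t-s)\le k_n\}=o_P^*(1)$, where the asterisk denotes outer probability. **Proposition.** Assume (C), (W), (A1) and (A2), and assume that either the support of $H$ is bounded away from the diagonal $\{(t,t):t\in[0,1]\}$ or (A3) holds. Put $\mathbb V_{s,t}=\phi_x'\mathbb Y(s,t)$ and $$V_n(H)=\int_\Delta\big(\mathbb V_n(s,t)-(t-s)\mathbb V_n(0,1)\big)\big(\mathbb V_n(s,t)-(t-s)\mathbb V_n(0,1)\big)^T\,dH(s,t),$$ $$W(H)=\int_\Delta\big(\mathbb V_{s,t}-(t-s)\mathbb V_{0,1}\big)\big(\mathbb V_{s,t}-(t-s)\mathbb V_{0,1}\big)^T\,dH(s,t).$$ If $W(H)$ is almost surely nonsingular, then the generalized self-normalized statistic satisfies $$G_n(H)=\mathbb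 V_n(0,1)^T\,V_n(H)^{-1}\,\mathbb V_n(0,1)\ \rightsquigarrow\ \mathbb V_{0,1}^T\,W(H)^{-1}\,\mathbb V_{0,1}$$ (with any convention for $V_n(H)^{-1}$ when $V_n(H)$ is singular, for example $0$). -/

import Mathlib

open MeasureTheory Filter Topology
open scoped ENNReal

noncomputable section

namespace SubSample

/-! ### Outer expectations and weak convergence in the Hoffmann-Joergensen sense -/

/-- The outer expectation `E^* h`: the infimum of `E U` over all measurable, integrable `U ≥ h`
(used below for bounded `h` only, and on probability spaces, so that the infimum is taken over a
nonempty set which is bounded below). -/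
def outerExpectation {Ω : Type*} [MeasurableSpace Ω] (P : Measure Ω) (h : Ω → ℝ) : ℝ :=
  sInf {r : ℝ | ∃ U : Ω → ℝ, Measurable U ∧ Integrable U P ∧ (∀ ω, h ω ≤ U ω) ∧
    r = ∫ ω, U ω ∂P}

/-- Weak convergence of arbitrary (possibly non-measurable) maps `Z n : Ω → D` to a
Borel measurable limit `Z₀ : Ω' → D`: `E^* f(Z n) → E f(Z₀)` for every bounded continuous
`f : D → ℝ`.  The limit is only required to be Borel measurable up to a null set. -/
def WeaklyConverges {D Ω Ω' : Type*} [TopologicalSpace D] [MeasurableSpace Ω] [MeasurableSpace Ω']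
    (P : Measure Ω) (Z : ℕ → Ω → D) (P' : Measure Ω') (Z₀ : Ω' → D) : Prop :=
  @AEMeasurable Ω' D (borel D) _ Z₀ P' ∧
    ∀ f : BoundedContinuousFunction D ℝ,
      Tendsto (fun n => outerExpectation P (fun ω => f (Z n ω))) atTop
        (𝓝 (∫ ω', f (Z₀ ω') ∂P'))

/-! ### Index sets and function spaces -/

/-- `Δ = {(s,t) ∈ [0,1]² : s ≤ t}`. -/
def Triangle : Set (ℝ × ℝ) := {q | 0 ≤ q.1 ∧ q.1 ≤ q.2 ∧ q.2 ≤ 1}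

/-- The length `t - s` of `(s,t) ∈ Δ`. -/
def len (q : Triangle) : ℝ := q.1.2 - q.1.1

/-- The point `(0,1) ∈ Δ`, which corresponds to the full sample. -/
def full : Triangle := ⟨(0, 1), by norm_num [Triangle]⟩

/-- `ℓ^∞(𝓕₁) × ... × ℓ^∞(𝓕_J)` with the maximum norm, for classes `𝓕_j` of functions `𝓧 → ℝ`. -/
abbrev LInf {𝓧 : Type*} {J : ℕ} (𝓕 : Fin J → Set (𝓧 → ℝ)) : Type _ :=
  ∀ j : Fin J, lp (fun _ : 𝓕 j => ℝ) ∞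

/-- `𝓛^∞(𝓕₁,...,𝓕_J;Δ)`, the space of uniformly bounded families, indexed by `Δ`, of elements of
`ℓ^∞(𝓕₁) × ... × ℓ^∞(𝓕_J)`, with the supremum norm. -/
abbrev PathSpace {𝓧 : Type*} {J : ℕ} (𝓕 : Fin J → Set (𝓧 → ℝ)) : Type _ :=
  lp (fun _ : Triangle => LInf 𝓕) ∞

/-- The norm `sup_{(s,t)} sup_j sup_f |y_j(s,t,f)|` of `𝓛^∞(𝓕₁,...,𝓕_J;Δ)` (the instances below
are Mathlib's; they are repeated to shorten the instance search). -/
instance instNormedPathSpace {𝓧 : Type*} {J : ℕ} (𝓕 : Fin J → Set (𝓧 → ℝ)) :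
    NormedAddCommGroup (PathSpace 𝓕) :=
  lp.normedAddCommGroup

instance instPseudoMetricPathSpace {𝓧 : Type*} {J : ℕ} (𝓕 : Fin J → Set (𝓧 → ℝ)) :
    PseudoMetricSpace (PathSpace 𝓕) :=
  (instNormedPathSpace 𝓕).toSeminormedAddCommGroup.toPseudoMetricSpace

instance instTopologicalPathSpace {𝓧 : Type*} {J : ℕ} (𝓕 : Fin J → Set (𝓧 → ℝ)) :
    TopologicalSpace (PathSpace 𝓕) :=
  (instPseudoMetricPathSpace 𝓕).toUniformSpace.toTopologicalSpace

/-! ### Estimators from sub-samples -/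

/-- Each class has a finite pointwise envelope, `sup_{f ∈ 𝓕_j} |f z| < ∞` for every `z`. -/
def FiniteEnvelope {𝓧 : Type*} {J : ℕ} (𝓕 : Fin J → Set (𝓧 → ℝ)) : Prop :=
  ∀ j z, BddAbove (Set.range fun f : 𝓕 j => |f.1 z|)

/-- The evaluation `((f z)_{f ∈ 𝓕₁}, ..., (f z)_{f ∈ 𝓕_J})` at an observation `z`. -/
def evalAt {𝓧 : Type*} {J : ℕ} {𝓕 : Fin J → Set (𝓧 → ℝ)} (h𝓕 : FiniteEnvelope 𝓕) (z : 𝓧) :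
    LInf 𝓕 :=
  fun j => ⟨fun f => f.1 z, memℓp_infty (h𝓕 j z)⟩

/-- The estimator `ŷ_{n,s,t}`: the average of `f (X_i)`, `f ∈ 𝓕_j`, over the sub-sample
`⌊ns⌋ + 1 ≤ i ≤ ⌊nt⌋`, and `0` if this sub-sample is empty. -/
def yHat {𝓧 Ω : Type*} {J : ℕ} {𝓕 : Fin J → Set (𝓧 → ℝ)} (h𝓕 : FiniteEnvelope 𝓕)
    (X : ℕ → Ω → 𝓧) (n : ℕ) (q : Triangle) (ω : Ω) : LInf 𝓕 :=
  ((⌊(n : ℝ) * q.1.2⌋₊ : ℝ) - (⌊(n : ℝ) * q.1.1⌋₊ : ℝ))⁻¹ •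
    ∑ i ∈ Finset.Ioc ⌊(n : ℝ) * q.1.1⌋₊ ⌊(n : ℝ) * q.1.2⌋₊, evalAt h𝓕 (X i ω)

/-- Sanity check: the coordinates of `ŷ_{n,s,t}` are the sub-sample averages. -/
theorem yHat_apply {𝓧 Ω : Type*} {J : ℕ} {𝓕 : Fin J → Set (𝓧 → ℝ)} (h𝓕 : FiniteEnvelope 𝓕)
    (X : ℕ → Ω → 𝓧) (n : ℕ) (q : Triangle) (ω : Ω) (j : Fin J) (f : 𝓕 j) :
    yHat h𝓕 X n q ω j f =
      (∑ i ∈ Finset.Ioc ⌊(n : ℝ) * q.1.1⌋₊ ⌊(n : ℝ) * q.1.2⌋₊, f.1 (X i ω)) /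
        ((⌊(n : ℝ) * q.1.2⌋₊ : ℝ) - (⌊(n : ℝ) * q.1.1⌋₊ : ℝ)) := by
  simp only [yHat, Pi.smul_apply, Finset.sum_apply, lp.coeFn_smul, lp.coeFn_sum, smul_eq_mul]
  rw [div_eq_inv_mul]
  rfl

theorem norm_yHat_le {𝓧 Ω : Type*} {J : ℕ} {𝓕 : Fin J → Set (𝓧 → ℝ)} (h𝓕 : FiniteEnvelope 𝓕)
    (X : ℕ → Ω → 𝓧) (n : ℕ) (q : Triangle) (ω : Ω) :
    ‖yHat h𝓕 X n q ω‖ ≤ ∑ i ∈ Finset.Ioc 0 n, ‖evalAt h𝓕 (X i ω)‖ := by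
  obtain ⟨⟨s, t⟩, h0, hst, h1⟩ := q
  simp only at h0 hst h1
  have hle : ⌊(n : ℝ) * s⌋₊ ≤ ⌊(n : ℝ) * t⌋₊ :=
    Nat.floor_mono (mul_le_mul_of_nonneg_left hst (Nat.cast_nonneg n))
  have htn : ⌊(n : ℝ) * t⌋₊ ≤ n := by
    refine Nat.floor_le_of_le ?_
    nlinarith [(Nat.cast_nonneg n : (0 : ℝ) ≤ n)]
  have hinv : ‖((⌊(n : ℝ) * t⌋₊ : ℝ) - (⌊(n : ℝ) * s⌋₊ : ℝ))⁻¹‖ ≤ 1 := by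
    rw [← Nat.cast_sub hle, norm_inv, Real.norm_natCast]
    exact Nat.cast_inv_le_one _
  have hsub : Finset.Ioc ⌊(n : ℝ) * s⌋₊ ⌊(n : ℝ) * t⌋₊ ⊆ Finset.Ioc 0 n :=
    Finset.Ioc_subset_Ioc (Nat.zero_le _) htn
  have hnn : ∀ i ∈ Finset.Ioc 0 n, 0 ≤ ‖evalAt h𝓕 (X i ω)‖ := fun i _ => norm_nonneg _
  calc ‖yHat h𝓕 X n ⟨(s, t), h0, hst, h1⟩ ω‖
      ≤ 1 * ∑ i ∈ Finset.Ioc ⌊(n : ℝ) * s⌋₊ ⌊(n : ℝ) * t⌋₊, ‖evalAt h𝓕 (X i ω)‖ := by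
        refine (norm_smul_le _ _).trans ?_
        exact mul_le_mul hinv (norm_sum_le _ _) (norm_nonneg _) zero_le_one
    _ ≤ _ := by
        rw [one_mul]
        exact Finset.sum_le_sum_of_subset_of_nonneg hsub (fun i hi _ => hnn i hi)

/-- The process `𝕐_n(s,t) = (t-s) α_n (ŷ_{n,s,t} - x)`, as a random element of
`𝓛^∞(𝓕₁,...,𝓕_J;Δ)`. -/
def yProc {𝓧 Ω : Type*} {J : ℕ} {𝓕 : Fin J → Set (𝓧 → ℝ)} (h𝓕 : FiniteEnvelope 𝓕)
    (X : ℕ → Ω → 𝓧) (α : ℕ → ℝ) (x : LInf 𝓕) (n : ℕ) (ω : Ω) : PathSpace 𝓕 :=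
  ⟨fun q => (len q * α n) • (yHat h𝓕 X n q ω - x), by
    refine memℓp_infty
      ⟨|α n| * ((∑ i ∈ Finset.Ioc 0 n, ‖evalAt h𝓕 (X i ω)‖) + ‖x‖), ?_⟩
    rintro _ ⟨q, rfl⟩
    have hq : |len q| ≤ 1 := by
      obtain ⟨⟨s, t⟩, h0, hst, h1⟩ := q
      simp only [len] at h0 hst h1 ⊢
      rw [abs_le]
      constructor <;> linarith
    have h2 : ‖yHat h𝓕 X n q ω - x‖ ≤ (∑ i ∈ Finset.Ioc 0 n, ‖evalAt h𝓕 (X i ω)‖) + ‖x‖ :=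
      (norm_sub_le _ _).trans (add_le_add_left (norm_yHat_le h𝓕 X n q ω) _)
    have h3 : ‖len q * α n‖ ≤ |α n| := by
      rw [norm_mul, Real.norm_eq_abs, Real.norm_eq_abs]
      exact mul_le_of_le_one_left (abs_nonneg _) hq
    refine (norm_smul_le _ _).trans ?_
    exact mul_le_mul h3 h2 (norm_nonneg _) (abs_nonneg _)⟩

/-- The vector `𝕍_n(s,t) = (t-s) α_n (φ(ŷ_{n,s,t}) - φ(x)) ∈ ℝ^p`. -/
def vProc {𝓧 Ω : Type*} {J p : ℕ} {𝓕 : Fin J → Set (𝓧 → ℝ)} (h𝓕 : FiniteEnvelope 𝓕)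
    (X : ℕ → Ω → 𝓧) (α : ℕ → ℝ) (x : LInf 𝓕) (φ : LInf 𝓕 → Fin p → ℝ)
    (n : ℕ) (ω : Ω) (q : Triangle) : Fin p → ℝ :=
  (len q * α n) • (φ (yHat h𝓕 X n q ω) - φ x)

/-! ### The self-normalized statistic -/

/-- For a path `v : Δ → ℝ^p`, the matrix
`∫_Δ (v_{s,t} - (t-s) v_{0,1}) (v_{s,t} - (t-s) v_{0,1})ᵀ dH(s,t)`. -/
def normalizer {p : ℕ} (H : Measure Triangle) (v : Triangle → Fin p → ℝ) :
    Matrix (Fin p) (Fin p) ℝ :=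
  fun i j => ∫ q, (v q - len q • v full) i * (v q - len q • v full) j ∂H

/-- For a path `v : Δ → ℝ^p`, the number `v_{0,1}ᵀ M⁻¹ v_{0,1}` with `M = normalizer H v`. -/
def selfNormalized {p : ℕ} (H : Measure Triangle) (v : Triangle → Fin p → ℝ) : ℝ :=
  dotProduct (v full) (Matrix.mulVec (normalizer H v)⁻¹ (v full))

/-! ### The assumptions -/

/-- Compact (Hadamard) differentiability of `φ : D → F` at `x ∈ D`, tangentially to `V`, with
derivative `φ'`.  Only the values of `φ` on its domain `D` and those of `φ'` on `V` matter. (If `F`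
is finite dimensional, a continuous linear map on the span of `V` is the same as the restriction of
a continuous linear map on the whole space.) -/
def CompactlyDifferentiableAt {E F : Type*} [NormedAddCommGroup E] [NormedSpace ℝ E]
    [NormedAddCommGroup F] [NormedSpace ℝ F]
    (φ : E → F) (D V : Set E) (φ' : E →L[ℝ] F) (x : E) : Prop :=
  x ∈ D ∧ ∀ (r : ℕ → ℝ) (h : ℕ → E) (h₀ : E), (∀ n, 0 < r n) → Tendsto r atTop (𝓝 0) →
    Tendsto h atTop (𝓝 h₀) → h₀ ∈ V → (∀ n, x + r n • h n ∈ D) →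
    Tendsto (fun n => (r n)⁻¹ • (φ (x + r n • h n) - φ x)) atTop (𝓝 (φ' h₀))

/-- Condition (C): compact differentiability tangentially to a set `V` which contains `0` and is
closed under multiplication by positive constants. -/
def CondC {E F : Type*} [NormedAddCommGroup E] [NormedSpace ℝ E]
    [NormedAddCommGroup F] [NormedSpace ℝ F]
    (φ : E → F) (D V : Set E) (φ' : E →L[ℝ] F) (x : E) : Prop :=
  CompactlyDifferentiableAt φ D V φ' x ∧ (0 : E) ∈ V ∧ ∀ f ∈ V, ∀ c : ℝ, 0 < c → c • f ∈ V

/-- Condition (W): `𝕐_n` converges weakly in `𝓛^∞(𝓕₁,...,𝓕_J;Δ)` to a centered, Borel measurable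
process `𝕐`. -/
def CondW {𝓧 Ω Ω' : Type*} [MeasurableSpace Ω] [MeasurableSpace Ω'] {J : ℕ}
    {𝓕 : Fin J → Set (𝓧 → ℝ)} (h𝓕 : FiniteEnvelope 𝓕) (X : ℕ → Ω → 𝓧) (P : Measure Ω)
    (α : ℕ → ℝ) (x : LInf 𝓕) (P' : Measure Ω') (Y : Ω' → PathSpace 𝓕) : Prop :=
  WeaklyConverges P (yProc h𝓕 X α x) P' Y ∧
    ∀ (q : Triangle) (j : Fin J) (f : 𝓕 j),
      Integrable (fun ω' => Y ω' q j f) P' ∧ ∫ ω', Y ω' q j f ∂P' = 0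

/-- Condition (A1): `sup_{|s-s'|+|t-t'| ≤ δ} sup_j sup_{f ∈ 𝓕_j} |𝕐_j(s,t,f) - 𝕐_j(s',t',f)|`
converges to `0` in probability as `δ → 0`; here `(s,t), (s',t')` range over `K`. -/
def CondA1 {𝓧 Ω' : Type*} [MeasurableSpace Ω'] {J : ℕ} {𝓕 : Fin J → Set (𝓧 → ℝ)}
    (P' : Measure Ω') (Y : Ω' → PathSpace 𝓕) (K : Set Triangle) : Prop :=
  ∀ ε : ℝ, 0 < ε →
    Tendsto (fun δ : ℝ => P' {ω' | ∃ q ∈ K, ∃ q' ∈ K,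
      |q.1.1 - q'.1.1| + |q.1.2 - q'.1.2| ≤ δ ∧ ε < ‖Y ω' q - Y ω' q'‖}) (𝓝[>] 0) (𝓝 0)

/-- Condition (A2): almost surely, `𝕐(s,t,·) ∈ V` for all `(s,t) ∈ K`. -/
def CondA2 {𝓧 Ω' : Type*} [MeasurableSpace Ω'] {J : ℕ} {𝓕 : Fin J → Set (𝓧 → ℝ)}
    (P' : Measure Ω') (Y : Ω' → PathSpace 𝓕) (V : Set (LInf 𝓕)) (K : Set Triangle) : Prop :=
  ∀ᵐ ω' ∂P', ∀ q ∈ K, Y ω' q ∈ V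

/-- Condition (A3): for any `k_n → 0`, the supremum of `α_n (t-s) ‖φ(ŷ_{n,s,t})‖` over those
`(s,t) ∈ K` with `α_n (t-s) ≤ k_n` converges to `0` in outer probability. -/
def CondA3 {𝓧 Ω : Type*} [MeasurableSpace Ω] {J p : ℕ} {𝓕 : Fin J → Set (𝓧 → ℝ)}
    (h𝓕 : FiniteEnvelope 𝓕) (X : ℕ → Ω → 𝓧) (P : Measure Ω) (α : ℕ → ℝ)
    (φ : LInf 𝓕 → Fin p → ℝ) (K : Set Triangle) : Prop :=
  ∀ k : ℕ → ℝ, Tendsto k atTop (𝓝 0) → ∀ ε : ℝ, 0 < ε →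
    Tendsto (fun n => P {ω | ∃ q ∈ K, α n * len q ≤ k n ∧
      ε < α n * len q * ‖φ (yHat h𝓕 X n q ω)‖}) atTop (𝓝 0)

end SubSample

end

/-! The core is deterministic. Let `n → ∞` and let realizations of `𝕐_n` approach a path `z` that is
continuous on `K` with values in `V`. Then `𝕍_n - φ' ∘ z → 0` uniformly on a set `K' ⊆ K` of full
`H`-measure (`tendsto_vProc_sub`). The difficulty is that the rate `a = (t-s) α_n` of the delta
method degenerates near the diagonal. By compactness of `K` it suffices to follow points `q → q₀`
and to distinguish the behaviour of `a`. If `a → ∞`, differentiability applies with step `1/a`. If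
`a` stays bounded, `q₀` lies on the diagonal, where `z` vanishes, and `𝕍_n → 0` has to be shown:
when `a` stays away from `0`, then `ŷ → x` and `φ` is continuous at `x` within `D`; when `a → 0`, `a
‖φ(ŷ)‖` is small by (A3).

Uniform convergence passes to the matrices by dominated convergence, and to the statistic because
inversion is continuous at nonsingular matrices (`tendsto_selfNormalized`). The random statement
follows from an extended continuous mapping theorem, `WeaklyConverges.of_tendsto_approach`. It
tolerates exceptional events of small outer probability, as required by (A3), which holds only in
probability. If the support of `H` avoids the diagonal, `K'` can be chosen to avoid it too, and `a →
∞` uniformly on `K'`. -/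

namespace SubSample

/-! ### Outer expectations -/

section OuterExpectation

variable {Ω : Type*} [MeasurableSpace Ω] {P : Measure Ω} [IsProbabilityMeasure P]
  {h : Ω → ℝ} {M : ℝ}

theorem outerExpectation_le_integral (hM : ∀ ω, |h ω| ≤ M) {U : Ω → ℝ} (hU : Measurable U)
    (hUi : Integrable U P) (hhU : ∀ ω, h ω ≤ U ω) : outerExpectation P h ≤ ∫ ω, U ω ∂P := by
  refine csInf_le ⟨-M, ?_⟩ ⟨U, hU, hUi, hhU, rfl⟩
  rintro _ ⟨U', -, hUi', hhU', rfl⟩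
  calc -M = ∫ _, -M ∂P := by simp
    _ ≤ ∫ ω, U' ω ∂P := integral_mono (integrable_const _) hUi'
        fun ω => (neg_le_of_abs_le (hM ω)).trans (hhU' ω)

theorem le_outerExpectation (hM : ∀ ω, |h ω| ≤ M) {c : ℝ}
    (hc : ∀ U : Ω → ℝ, Measurable U → Integrable U P → (∀ ω, h ω ≤ U ω) → c ≤ ∫ ω, U ω ∂P) :
    c ≤ outerExpectation P h := by
  refine le_csInf ⟨_, fun _ => M, measurable_const, integrable_const _,
    fun ω => (le_abs_self _).trans (hM ω), rfl⟩ ?_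
  rintro _ ⟨U, hU, hUi, hhU, rfl⟩
  exact hc U hU hUi hhU

/-- Markov's inequality for every majorant; `S` need not be measurable, and `P.real S` is then its
outer probability. -/
theorem measureReal_le_outerExpectation (hM : ∀ ω, |h ω| ≤ M) (h0 : ∀ ω, 0 ≤ h ω) {S : Set Ω}
    (hS : ∀ ω ∈ S, 1 ≤ h ω) : P.real S ≤ outerExpectation P h := by
  refine le_outerExpectation hM fun U hU hUi hhU => ?_
  calc P.real S ≤ P.real {ω | 1 ≤ U ω} := measureReal_mono fun ω hω => (hS ω hω).trans (hhU ω)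
    _ = 1 * P.real {ω | 1 ≤ U ω} := (one_mul _).symm
    _ ≤ ∫ ω, U ω ∂P := mul_meas_ge_le_integral_of_nonneg
        (Eventually.of_forall fun ω => (h0 ω).trans (hhU ω)) hUi 1

/-- Inner expectations are at most outer ones: majorants of `h` and of `-h` have a nonnegative sum.
-/
theorem neg_outerExpectation_neg_le (hM : ∀ ω, |h ω| ≤ M) :
    -outerExpectation P (fun ω => -h ω) ≤ outerExpectation P h := by
  refine le_outerExpectation hM fun U hU hUi hhU => ?_
  rw [neg_le]
  refine le_outerExpectation (M := M) (by simpa using hM) fun U' hU' hUi' hhU' => ?_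
  rw [← integral_neg]
  refine integral_mono hUi.neg hUi' fun ω => ?_
  have h1 := hhU ω
  have h2 := hhU' ω
  change -U ω ≤ U' ω
  linarith

end OuterExpectation

/-! ### The portmanteau theorem and an extended continuous mapping theorem -/

/-- The sum equals `⌊t⌋₊`. Rescaled, this sandwiches a bounded function between step functions built
from its superlevel sets. -/
theorem sum_layer_bounds {N : ℕ} {t : ℝ} (h0 : 0 ≤ t) (hN : t < N + 1) :
    (∑ i ∈ Finset.range N, if ((i : ℝ) + 1 ≤ t) then (1 : ℝ) else 0) ≤ t ∧
      t ≤ 1 + ∑ i ∈ Finset.range N, if ((i : ℝ) + 1 ≤ t) then (1 : ℝ) else 0 := by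
  have hfl : ⌊t⌋₊ ≤ N := by
    have := (Nat.floor_lt h0).2 (show t < ((N + 1 : ℕ) : ℝ) by push_cast; exact hN)
    omega
  have hset : (Finset.range N).filter (fun i : ℕ => (i : ℝ) + 1 ≤ t) = Finset.range ⌊t⌋₊ := by
    ext i
    simp only [Finset.mem_filter, Finset.mem_range]
    have : (i : ℝ) + 1 ≤ t ↔ i + 1 ≤ ⌊t⌋₊ := by
      rw [Nat.le_floor_iff h0]; push_cast; rfl
    rw [this]; omega
  rw [← Finset.sum_filter, hset]
  simp only [Finset.sum_const, Finset.card_range, nsmul_eq_mul, mul_one]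
  exact ⟨Nat.floor_le h0, by linarith [Nat.lt_floor_add_one t]⟩

theorem measureReal_map_closed {D Ω' : Type*} [MeasurableSpace Ω'] {P' : Measure Ω'}
    [TopologicalSpace D] [MeasurableSpace D] [BorelSpace D] {Z₀ : Ω' → D} (hZ₀ : AEMeasurable Z₀ P')
    {C : Set D} (hC : IsClosed C) :
    (P'.map Z₀).real C = P'.real {ω' | Z₀ ω' ∈ C} := by
  rw [measureReal_def, Measure.map_apply_of_aemeasurable hZ₀ hC.measurableSet]
  rfl

section WeakConvergence

variable {D E Ω Ω' : Type*} [MeasurableSpace Ω] [MeasurableSpace Ω'] {P : Measure Ω}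
  {P' : Measure Ω'} [IsProbabilityMeasure P] [IsProbabilityMeasure P']

/-- Continuous thickened indicators of `C` dominate its indicator, and their integrals under the
limit law tend to the mass of `C`. -/
theorem WeaklyConverges.eventually_measureReal_le [PseudoMetricSpace D] {Z : ℕ → Ω → D}
    {Z₀ : Ω' → D} (hZ : WeaklyConverges P Z P' Z₀) {C : Set D} (hC : IsClosed C) {ε : ℝ}
    (hε : 0 < ε) :
    ∀ᶠ n in atTop, P.real {ω | Z n ω ∈ C} ≤ P'.real {ω' | Z₀ ω' ∈ C} + ε := by
  let _ : MeasurableSpace D := borel D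
  have : BorelSpace D := ⟨rfl⟩
  obtain ⟨hm, hf⟩ := hZ
  have hm : AEMeasurable Z₀ P' := hm
  have : IsProbabilityMeasure (P'.map Z₀) := Measure.isProbabilityMeasure_map hm
  have hpos : ∀ n : ℕ, (0 : ℝ) < 1 / ((n : ℝ) + 1) := fun n => by positivity
  have hlim := tendsto_lintegral_thickenedIndicator_of_isClosed (P'.map Z₀) hC hpos
    tendsto_one_div_add_atTop_nhds_zero_nat
  have hlim' := (ENNReal.tendsto_toReal (measure_ne_top (P'.map Z₀) C)).comp hlim
  rw [← measureReal_def, measureReal_map_closed hm hC] at hlim'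
  obtain ⟨m, hm'⟩ := (hlim'.eventually_lt_const
    (show P'.real {ω' | Z₀ ω' ∈ C} < P'.real {ω' | Z₀ ω' ∈ C} + ε by linarith)).exists
  have hbd : ∀ z, ‖((thickenedIndicator (hpos m) C z : NNReal) : ℝ)‖ ≤ 1 := fun z => by
    rw [Real.norm_eq_abs, NNReal.abs_eq]
    exact_mod_cast thickenedIndicator_le_one (hpos m) C z
  let f : BoundedContinuousFunction D ℝ := BoundedContinuousFunction.ofNormedAddCommGroup
    (fun z => ((thickenedIndicator (hpos m) C z : NNReal) : ℝ))
    (NNReal.continuous_coe.comp (thickenedIndicator (hpos m) C).continuous) 1 hbd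
  have hint : ∫ ω', f (Z₀ ω') ∂P' < P'.real {ω' | Z₀ ω' ∈ C} + ε := by
    rw [← integral_map (f := fun z => f z) hm f.continuous.aestronglyMeasurable]
    refine lt_of_eq_of_lt ?_ hm'
    rw [integral_eq_lintegral_of_nonneg_ae (f := f)
      (Eventually.of_forall fun z => NNReal.coe_nonneg _) f.continuous.aestronglyMeasurable]
    exact congrArg ENNReal.toReal (lintegral_congr fun z => ENNReal.ofReal_coe_nnreal)
  filter_upwards [(hf f).eventually_lt_const hint] with n hn
  refine (measureReal_le_outerExpectation (M := 1) (fun ω => hbd _)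
    (fun ω => NNReal.coe_nonneg _) fun ω hω => ?_).trans hn.le
  have := thickenedIndicator_one (hpos m) C hω
  change (1 : ℝ) ≤ ((thickenedIndicator (hpos m) C (Z n ω) : NNReal) : ℝ)
  rw [this, NNReal.coe_one]

theorem eventually_outerExpectation_le [TopologicalSpace E] {W : ℕ → Ω → E} {W₀ : Ω' → E}
    (hm : @AEMeasurable Ω' E (borel E) _ W₀ P')
    (hcl : ∀ F : Set E, IsClosed F → ∀ ε : ℝ, 0 < ε →
      ∀ᶠ n in atTop, P.real {ω | W n ω ∈ F} ≤ P'.real {ω' | W₀ ω' ∈ F} + ε)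
    (f : BoundedContinuousFunction E ℝ) {ε : ℝ} (hε : 0 < ε) :
    ∀ᶠ n in atTop, outerExpectation P (fun ω => f (W n ω)) ≤ (∫ ω', f (W₀ ω') ∂P') + ε := by
  let _ : MeasurableSpace E := borel E
  have : BorelSpace E := ⟨rfl⟩
  have hm : AEMeasurable W₀ P' := hm
  have : IsProbabilityMeasure (P'.map W₀) := Measure.isProbabilityMeasure_map hm
  set M : ℝ := ‖f‖
  have hfM : ∀ z, |f z| ≤ M := fun z => f.norm_coe_le_norm z
  set η : ℝ := ε / 2 with hη
  have hη0 : 0 < η := by positivity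
  -- With this `N`, the `N` levels `-M + η (i + 1)` exhaust the range `[-M, M]` of `f`.
  obtain ⟨N, hN⟩ := exists_nat_gt (2 * M / η)
  have hlayer : ∀ z, -M + η * (∑ i ∈ Finset.range N,
        if -M + η * ((i : ℝ) + 1) ≤ f z then (1 : ℝ) else 0) ≤ f z ∧
      f z ≤ -M + η + η * (∑ i ∈ Finset.range N,
        if -M + η * ((i : ℝ) + 1) ≤ f z then (1 : ℝ) else 0) := fun z => by
    have hz := abs_le.1 (hfM z)
    have h0 : 0 ≤ (f z + M) / η := div_nonneg (by linarith) hη0.le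
    have h1 : (f z + M) / η < N + 1 := by
      have : (f z + M) / η ≤ 2 * M / η := by gcongr; linarith
      linarith
    have h2 := sum_layer_bounds h0 h1
    have h3 : ∀ i : ℕ, ((i : ℝ) + 1 ≤ (f z + M) / η) ↔ (-M + η * ((i : ℝ) + 1) ≤ f z) :=
      fun i => by
        rw [le_div_iff₀ hη0, mul_comm]
        constructor <;> intro h <;> linarith
    simp only [h3, div_le_iff₀ hη0, le_div_iff₀ hη0] at h2
    constructor <;> nlinarith [h2.1, h2.2]
  set F : ℕ → Set E := fun i => {z | -M + η * ((i : ℝ) + 1) ≤ f z} with hF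
  have hFc : ∀ i, IsClosed (F i) := fun i => isClosed_le continuous_const f.continuous
  have hlow : -M + η * ∑ i ∈ Finset.range N, P'.real {ω' | W₀ ω' ∈ F i} ≤
      ∫ ω', f (W₀ ω') ∂P' := by
    have hint : ∀ i, Integrable ((F i).indicator (1 : E → ℝ)) (P'.map W₀) := fun i =>
      (integrable_const (1 : ℝ)).indicator (hFc i).measurableSet
    have heq : -M + η * ∑ i ∈ Finset.range N, P'.real {ω' | W₀ ω' ∈ F i} =
        ∫ z, (-M + η * ∑ i ∈ Finset.range N, (F i).indicator (1 : E → ℝ) z) ∂(P'.map W₀) := by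
      rw [integral_add (integrable_const _)
        ((integrable_finsetSum _ fun i _ => hint i).const_mul _), integral_const_mul,
        integral_finsetSum _ fun i _ => hint i]
      simp only [integral_const, probReal_univ, one_smul]
      congr 2
      refine Finset.sum_congr rfl fun i _ => ?_
      rw [integral_indicator_one (hFc i).measurableSet, measureReal_map_closed hm (hFc i)]
    rw [heq, ← integral_map (f := fun z => f z) hm f.continuous.aestronglyMeasurable]
    refine integral_mono ((integrable_const _).add
      ((integrable_finsetSum _ fun i _ => hint i).const_mul _)) (f.integrable _) fun z => ?_
    refine le_of_eq_of_le ?_ (hlayer z).1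
    simp [Set.indicator_apply, hF]
  -- The `N` tolerances add up to at most `1`, which costs a second `η` after scaling; the first is
  -- the mesh of the layers, and `2 η = ε`.
  have hev : ∀ᶠ n in atTop, ∀ i ∈ Finset.range N, P.real {ω | W n ω ∈ F i} ≤
      P'.real {ω' | W₀ ω' ∈ F i} + 1 / ((N : ℝ) + 1) :=
    (Finset.eventually_all _).2 fun i _ => hcl _ (hFc i) _ (by positivity)
  filter_upwards [hev] with n hn
  -- Measurable hulls turn the step function into a measurable majorant without changing the outer
  -- probabilities.
  set S : ℕ → Set Ω := fun i => toMeasurable P {ω | W n ω ∈ F i} with hS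
  have hint : ∀ i, Integrable ((S i).indicator (1 : Ω → ℝ)) P := fun i =>
    (integrable_const (1 : ℝ)).indicator (measurableSet_toMeasurable _ _)
  have hUi : Integrable (fun ω => -M + η + η * ∑ i ∈ Finset.range N,
      (S i).indicator (1 : Ω → ℝ) ω) P :=
    (integrable_const _).add ((integrable_finsetSum _ fun i _ => hint i).const_mul _)
  have hUm : Measurable (fun ω => -M + η + η * ∑ i ∈ Finset.range N,
      (S i).indicator (1 : Ω → ℝ) ω) :=
    (Finset.measurable_fun_sum _ fun i _ =>
      measurable_one.indicator (measurableSet_toMeasurable _ _)).const_mul _ |>.const_add _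
  have hle := outerExpectation_le_integral (h := fun ω => f (W n ω)) (fun ω => hfM _) hUm hUi
    fun ω => by
      refine (hlayer (W n ω)).2.trans ?_
      gcongr with i _
      by_cases hi : -M + η * ((i : ℝ) + 1) ≤ f (W n ω)
      · have : ω ∈ S i := subset_toMeasurable P _ (show W n ω ∈ F i from hi)
        simp [hi, this]
      · simp only [hi, if_false]
        exact Set.indicator_nonneg (fun _ _ => zero_le_one) _
  have heq : ∫ ω, (-M + η + η * ∑ i ∈ Finset.range N, (S i).indicator (1 : Ω → ℝ) ω) ∂P =
      -M + η + η * ∑ i ∈ Finset.range N, P.real {ω | W n ω ∈ F i} := by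
    rw [integral_add (integrable_const _)
      ((integrable_finsetSum _ fun i _ => hint i).const_mul _), integral_const_mul,
      integral_finsetSum _ fun i _ => hint i]
    simp only [integral_const, probReal_univ, one_smul]
    congr 2
    refine Finset.sum_congr rfl fun i _ => ?_
    rw [integral_indicator_one (measurableSet_toMeasurable _ _), measureReal_def,
      measure_toMeasurable, measureReal_def]
  have hsum : ∑ i ∈ Finset.range N, P.real {ω | W n ω ∈ F i} ≤
      (∑ i ∈ Finset.range N, P'.real {ω' | W₀ ω' ∈ F i}) + 1 := by
    refine (Finset.sum_le_sum hn).trans ?_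
    rw [Finset.sum_add_distrib]
    gcongr
    simp only [Finset.sum_const, Finset.card_range, nsmul_eq_mul]
    rw [mul_one_div, div_le_one (by positivity)]
    linarith
  rw [heq] at hle
  nlinarith [mul_le_mul_of_nonneg_left hsum hη0.le]

/-- The part of the portmanteau theorem which deduces weak convergence from the inequalities
`limsup P^*(W n ∈ F) ≤ P(W₀ ∈ F)` for closed sets `F`. -/
theorem weaklyConverges_of_forall_isClosed [TopologicalSpace E] {W : ℕ → Ω → E} {W₀ : Ω' → E}
    (hm : @AEMeasurable Ω' E (borel E) _ W₀ P')
    (hcl : ∀ F : Set E, IsClosed F → ∀ ε : ℝ, 0 < ε →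
      ∀ᶠ n in atTop, P.real {ω | W n ω ∈ F} ≤ P'.real {ω' | W₀ ω' ∈ F} + ε) :
    WeaklyConverges P W P' W₀ := by
  refine ⟨hm, fun f => Metric.tendsto_nhds.2 fun ε hε => ?_⟩
  -- The upper bound for `-f` gives the lower bound for `f`, since inner expectations do not exceed
  -- outer ones.
  filter_upwards [eventually_outerExpectation_le hm hcl f (half_pos hε),
    eventually_outerExpectation_le hm hcl (-f) (half_pos hε)] with n h1 h2
  have h3 := neg_outerExpectation_neg_le (P := P) (h := fun ω => f (W n ω))
    fun ω => f.norm_coe_le_norm _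
  simp only [BoundedContinuousFunction.coe_neg, Pi.neg_apply, integral_neg] at h2
  rw [Real.dist_eq, abs_lt]
  constructor <;> linarith

/-- The pairs `(n, ω)` with `ω ∈ A n`, filtered by `n → ∞` and `Z n ω → z`. -/
def approach {D Ω : Type*} [TopologicalSpace D] (Z : ℕ → Ω → D) (A : ℕ → Set Ω) (z : D) :
    Filter (ℕ × Ω) :=
  comap Prod.fst atTop ⊓ comap (fun i => Z i.1 i.2) (𝓝 z) ⊓ 𝓟 {i | i.2 ∈ A i.1}

/-- An extended continuous mapping theorem: the map `g` is approximated along the sequences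
`Z n ω → z`, outside of events of small outer probability. -/
theorem WeaklyConverges.of_tendsto_approach [PseudoMetricSpace D] [TopologicalSpace E]
    {Z : ℕ → Ω → D} {Z₀ : Ω' → D} (hZ : WeaklyConverges P Z P' Z₀) {W : ℕ → Ω → E} {g : D → E}
    (hg : @AEMeasurable Ω' E (borel E) _ (fun ω' => g (Z₀ ω')) P')
    (hW : ∀ η : ℝ, 0 < η → ∃ A : ℕ → Set Ω, (∀ᶠ n in atTop, P.real (A n)ᶜ ≤ η) ∧
      ∀ᵐ ω' ∂P', Tendsto (fun i : ℕ × Ω => W i.1 i.2) (approach Z A (Z₀ ω'))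
        (𝓝 (g (Z₀ ω')))) :
    WeaklyConverges P W P' (fun ω' => g (Z₀ ω')) := by
  refine weaklyConverges_of_forall_isClosed hg fun F hF ε hε => ?_
  obtain ⟨A, hA, hlim⟩ := hW (ε / 3) (by positivity)
  set C : ℕ → Set D := fun k =>
    closure {z | ∃ m, k ≤ m ∧ ∃ ω ∈ A m, W m ω ∈ F ∧ Z m ω = z} with hC
  have hCanti : Antitone C := fun k l hkl => closure_mono fun z ⟨m, hm, h⟩ => ⟨m, hkl.trans hm, h⟩
  -- If `g z ∉ F`, all late `W m ω` with `ω ∈ A m` and `Z m ω` near `z` avoid `F`, so `z` lies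
  -- outside some `C k`.
  have hinter : P'.real {ω' | Z₀ ω' ∈ ⋂ k, C k} ≤ P'.real {ω' | g (Z₀ ω') ∈ F} := by
    refine ENNReal.toReal_mono (measure_ne_top _ _) (measure_mono_ae ?_)
    filter_upwards [hlim] with ω' hω' hmem
    by_contra hnot
    have hev := hω'.eventually (hF.isOpen_compl.mem_nhds hnot)
    rw [approach, eventually_inf_principal, eventually_inf] at hev
    obtain ⟨s, hs, t, ht, hst⟩ := hev
    obtain ⟨s', hs', hss⟩ := hs
    obtain ⟨k, hk⟩ := mem_atTop_sets.1 hs'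
    obtain ⟨t', ht', htt⟩ := ht
    obtain ⟨_, hzt, m, hkm, ω, hω, hWF, rfl⟩ :=
      mem_closure_iff_nhds.1 (Set.mem_iInter.1 hmem k) t' ht'
    exact hst (m, ω) ⟨hss (hk m hkm), htt hzt⟩ hω hWF
  let _ : MeasurableSpace D := borel D
  have : BorelSpace D := ⟨rfl⟩
  have hm : AEMeasurable Z₀ P' := hZ.1
  have : IsProbabilityMeasure (P'.map Z₀) := Measure.isProbabilityMeasure_map hm
  have hCk : Tendsto (fun k => P'.real {ω' | Z₀ ω' ∈ C k}) atTop
      (𝓝 (P'.real {ω' | Z₀ ω' ∈ ⋂ k, C k})) := by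
    rw [← measureReal_map_closed hm (isClosed_iInter fun k => isClosed_closure)]
    simp only [hC, ← measureReal_map_closed hm isClosed_closure]
    exact (ENNReal.tendsto_toReal (measure_ne_top _ _)).comp
      (tendsto_measure_iInter_atTop (fun k => isClosed_closure.measurableSet.nullMeasurableSet)
        hCanti ⟨0, measure_ne_top _ _⟩)
  obtain ⟨k, hk⟩ := (hCk.eventually_lt_const (show P'.real {ω' | Z₀ ω' ∈ ⋂ k, C k} <
    P'.real {ω' | Z₀ ω' ∈ ⋂ k, C k} + ε / 3 by linarith)).exists
  filter_upwards [hA, hZ.eventually_measureReal_le (isClosed_closure : IsClosed (C k))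
    (show 0 < ε / 3 by positivity), eventually_ge_atTop k] with n hn1 hn2 hn3
  have hsub : {ω | W n ω ∈ F} ⊆ (A n)ᶜ ∪ {ω | Z n ω ∈ C k} := fun ω hω => by
    by_cases h : ω ∈ A n
    · exact Or.inr (subset_closure ⟨n, hn3, ω, h, hω, rfl⟩)
    · exact Or.inl h
  have := (measureReal_mono (μ := P) hsub).trans (measureReal_union_le _ _)
  linarith

end WeakConvergence

/-! ### Compact differentiability along filters -/

section Differentiability

variable {E F ι : Type*} [NormedAddCommGroup E] [NormedSpace ℝ E] [NormedAddCommGroup F]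
  [NormedSpace ℝ F] {φ : E → F} {D V : Set E} {φ' : E →L[ℝ] F} {x : E}

/-- The universal filter for the pair (step, direction) is countably generated, so the sequential
definition suffices; dropping the first `N` terms turns eventual conditions into permanent ones. -/
theorem CompactlyDifferentiableAt.tendsto (hφ : CompactlyDifferentiableAt φ D V φ' x)
    {l : Filter ι} {r : ι → ℝ} {h : ι → E} {h₀ : E} (hr : Tendsto r l (𝓝[>] 0))
    (hh : Tendsto h l (𝓝 h₀)) (h₀V : h₀ ∈ V) (hD : ∀ᶠ i in l, x + r i • h i ∈ D) :
    Tendsto (fun i => (r i)⁻¹ • (φ (x + r i • h i) - φ x)) l (𝓝 (φ' h₀)) := by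
  have key : Tendsto (fun u : ℝ × E => u.1⁻¹ • (φ (x + u.1 • u.2) - φ x))
      (𝓝[>] 0 ×ˢ 𝓝 h₀ ⊓ 𝓟 {u | x + u.1 • u.2 ∈ D}) (𝓝 (φ' h₀)) := by
    refine tendsto_of_seq_tendsto fun u hu => ?_
    rw [tendsto_inf, tendsto_principal] at hu
    obtain ⟨hu, huD⟩ := hu
    have h1 : Tendsto (fun n => (u n).1) atTop (𝓝[>] 0) := tendsto_fst.comp hu
    have h2 : Tendsto (fun n => (u n).2) atTop (𝓝 h₀) := tendsto_snd.comp hu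
    rw [tendsto_nhdsWithin_iff] at h1
    obtain ⟨N, hN⟩ := eventually_atTop.1 (huD.and h1.2)
    rw [← tendsto_add_atTop_iff_nat N]
    exact hφ.2 _ _ h₀ (fun n => (hN (n + N) (Nat.le_add_left _ _)).2)
      ((tendsto_add_atTop_iff_nat N).2 h1.1) ((tendsto_add_atTop_iff_nat N).2 h2) h₀V
      (fun n => (hN (n + N) (Nat.le_add_left _ _)).1)
  exact key.comp (tendsto_inf.2 ⟨hr.prodMk hh, tendsto_principal.2 hD⟩)

theorem CompactlyDifferentiableAt.continuousWithinAt (hφ : CompactlyDifferentiableAt φ D V φ' x)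
    (h0 : (0 : E) ∈ V) : ContinuousWithinAt φ D x := by
  refine tendsto_of_seq_tendsto fun u hu => ?_
  rw [tendsto_nhdsWithin_iff] at hu
  obtain ⟨hu, huD⟩ := hu
  -- The square root makes both the step `r` and the direction `(u - x) / r` tend to `0`; the
  -- summand `1 / (n + 1)` keeps `r` positive where `u n = x`.
  set r : ℕ → ℝ := fun n => √‖u n - x‖ + 1 / ((n : ℝ) + 1) with hr
  have hpos : ∀ n, 0 < r n := fun n => by positivity
  have hsq : Tendsto (fun n => √‖u n - x‖) atTop (𝓝 0) := by
    have h1 : Tendsto (fun n => ‖u n - x‖) atTop (𝓝 0) := tendsto_iff_norm_sub_tendsto_zero.1 hu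
    simpa using h1.sqrt
  have hr0 : Tendsto r atTop (𝓝 0) := by
    simpa [hr] using hsq.add tendsto_one_div_add_atTop_nhds_zero_nat
  have hh : Tendsto (fun n => (r n)⁻¹ • (u n - x)) atTop (𝓝 0) := by
    refine squeeze_zero_norm (fun n => ?_) hsq
    rw [norm_smul, norm_inv, Real.norm_of_nonneg (hpos n).le, inv_mul_le_iff₀ (hpos n)]
    have h1 : √‖u n - x‖ * √‖u n - x‖ = ‖u n - x‖ := Real.mul_self_sqrt (norm_nonneg _)
    have h2 : 0 ≤ 1 / ((n : ℝ) + 1) * √‖u n - x‖ := by positivity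
    calc ‖u n - x‖ ≤ √‖u n - x‖ * √‖u n - x‖ + 1 / ((n : ℝ) + 1) * √‖u n - x‖ := by linarith
      _ = r n * √‖u n - x‖ := by rw [hr]; ring
  have hux : ∀ n, x + r n • (r n)⁻¹ • (u n - x) = u n := fun n => by
    rw [smul_inv_smul₀ (hpos n).ne']; abel
  have hdiff := hφ.tendsto (l := atTop) (r := r) (h := fun n => (r n)⁻¹ • (u n - x))
    (tendsto_nhdsWithin_iff.2 ⟨hr0, Eventually.of_forall hpos⟩) hh h0
    (by simpa only [hux] using huD)
  simp only [hux] at hdiff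
  have := hr0.smul hdiff
  simp only [smul_inv_smul₀ (hpos _).ne', zero_smul] at this
  exact tendsto_sub_nhds_zero_iff.1 this

end Differentiability

/-! ### The processes along `n → ∞` and `𝕐_n → z` -/

theorem len_nonneg (q : Triangle) : 0 ≤ len q := sub_nonneg.2 q.2.2.1

theorem len_le_one (q : Triangle) : len q ≤ 1 := by
  have h1 := q.2.1
  have h2 := q.2.2.2
  unfold len
  linarith

theorem len_full : len full = 1 := by simp [len, full]

theorem continuous_len : Continuous len := by
  unfold len
  fun_prop

section Processes

variable {𝓧 Ω : Type*} {J p : ℕ} {𝓕 : Fin J → Set (𝓧 → ℝ)} (h𝓕 : FiniteEnvelope 𝓕)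
  (X : ℕ → Ω → 𝓧) (α : ℕ → ℝ) (x : LInf 𝓕)

theorem yHat_eq_zero {n : ℕ} {q : Triangle} (ω : Ω)
    (h : ⌊(n : ℝ) * q.1.2⌋₊ ≤ ⌊(n : ℝ) * q.1.1⌋₊) : yHat h𝓕 X n q ω = 0 := by
  rw [yHat, Finset.Ioc_eq_empty (not_lt.2 h), Finset.sum_empty, smul_zero]

theorem mul_len_le_one {n : ℕ} {q : Triangle}
    (h : ⌊(n : ℝ) * q.1.2⌋₊ ≤ ⌊(n : ℝ) * q.1.1⌋₊) : n * len q ≤ 1 := by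
  have h1 : (n : ℝ) * q.1.2 < ⌊(n : ℝ) * q.1.2⌋₊ + 1 := Nat.lt_floor_add_one _
  have h2 : (⌊(n : ℝ) * q.1.1⌋₊ : ℝ) ≤ n * q.1.1 :=
    Nat.floor_le (mul_nonneg (Nat.cast_nonneg n) q.2.1)
  have h3 : (⌊(n : ℝ) * q.1.2⌋₊ : ℝ) ≤ ⌊(n : ℝ) * q.1.1⌋₊ := by exact_mod_cast h
  rw [len, mul_sub]
  linarith

theorem yProc_apply (n : ℕ) (ω : Ω) (q : Triangle) :
    yProc h𝓕 X α x n ω q = (len q * α n) • (yHat h𝓕 X n q ω - x) := rfl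

noncomputable instance instSeminormedPathSpace : SeminormedAddCommGroup (PathSpace 𝓕) :=
  (instNormedPathSpace 𝓕).toSeminormedAddCommGroup

theorem norm_apply_sub_le (y z : PathSpace 𝓕) (q : Triangle) : ‖y q - z q‖ ≤ ‖y - z‖ :=
  lp.norm_apply_le_norm ENNReal.top_ne_zero (y - z) q

theorem dist_apply_le (y z : PathSpace 𝓕) (q : Triangle) : dist (y q) (z q) ≤ dist y z := by
  rw [dist_eq_norm, dist_eq_norm]
  exact norm_apply_sub_le y z q

variable {h𝓕 X α x} {φ : LInf 𝓕 → Fin p → ℝ} {D V : Set (LInf 𝓕)}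
  {φ' : LInf 𝓕 →L[ℝ] (Fin p → ℝ)} {K K' : Set Triangle} {A : ℕ → Set Ω} {z : PathSpace 𝓕}

theorem tendsto_vProc_sub (hα : Tendsto α atTop atTop) (hC : CondC φ D V φ' x) (hK : IsCompact K)
    (hK' : K' ⊆ K)
    (hD : ∀ n, ∀ ω ∈ A n, ∀ q ∈ K, ⌊(n : ℝ) * q.1.1⌋₊ < ⌊(n : ℝ) * q.1.2⌋₊ →
      yHat h𝓕 X n q ω ∈ D)
    (hsmall : ∀ ε : ℝ, 0 < ε → ∃ δ : ℝ, 0 < δ ∧ ∀ᶠ n in atTop, ∀ ω ∈ A n, ∀ q ∈ K',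
      α n * len q ≤ δ → α n * len q * ‖φ (yHat h𝓕 X n q ω)‖ ≤ ε)
    (hzc : ContinuousOn (fun q => z q) K) (hzV : ∀ q ∈ K, z q ∈ V) :
    Tendsto (fun i : (ℕ × Ω) × Triangle => vProc h𝓕 X α x φ i.1.1 i.1.2 i.2 - φ' (z i.2))
      (approach (yProc h𝓕 X α x) A z ×ˢ 𝓟 K') (𝓝 0) := by
  -- An ultrafilter in `n`, `ω` and `q` jointly replaces the extraction of subsequences: `q`
  -- converges in `K`, and each alternative below either holds eventually or fails eventually.
  refine tendsto_iff_ultrafilter _ _ _ |>.2 fun 𝒰 h𝒰 => ?_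
  have hfst : Tendsto (fun i : (ℕ × Ω) × Triangle => i.1) 𝒰 (approach (yProc h𝓕 X α x) A z) :=
    tendsto_fst.mono_left h𝒰
  have hqK' : ∀ᶠ i in (𝒰 : Filter ((ℕ × Ω) × Triangle)), i.2 ∈ K' :=
    tendsto_principal.1 (tendsto_snd.mono_left h𝒰)
  have hqK : ∀ᶠ i in (𝒰 : Filter ((ℕ × Ω) × Triangle)), i.2 ∈ K := hqK'.mono fun i hi => hK' hi
  rw [approach, tendsto_inf, tendsto_inf, tendsto_comap_iff, tendsto_comap_iff,
    tendsto_principal] at hfst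
  obtain ⟨⟨hn, hY⟩, hA⟩ := hfst
  simp only [Function.comp_def, Set.mem_ofPred_eq] at hn hY hA
  obtain ⟨q₀, hq₀, hqlim⟩ := isCompact_iff_ultrafilter_le_nhds.1 hK
    (𝒰.map Prod.snd) (le_principal_iff.2 hqK)
  have hq : Tendsto (fun i : (ℕ × Ω) × Triangle => i.2) 𝒰 (𝓝 q₀) := hqlim
  have hzq : Tendsto (fun i : (ℕ × Ω) × Triangle => z i.2) 𝒰 (𝓝 (z q₀)) :=
    (hzc q₀ hq₀).tendsto.comp (tendsto_nhdsWithin_iff.2 ⟨hq, hqK⟩)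
  have hYz : Tendsto (fun i : (ℕ × Ω) × Triangle => yProc h𝓕 X α x i.1.1 i.1.2 i.2) 𝒰
      (𝓝 (z q₀)) := by
    refine (tendsto_iff_of_dist ?_).2 hzq
    exact squeeze_zero (fun _ => dist_nonneg) (fun i => dist_apply_le _ _ _)
      (tendsto_iff_dist_tendsto_zero.1 hY)
  have hlen : Tendsto (fun i : (ℕ × Ω) × Triangle => len i.2) 𝒰 (𝓝 (len q₀)) :=
    (continuous_len.tendsto q₀).comp hq
  have hαn : Tendsto (fun i : (ℕ × Ω) × Triangle => α i.1.1) 𝒰 atTop := hα.comp hn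
  -- On the diagonal the factor `len q₀` makes every `𝕐_n` vanish, hence also the limit.
  have hdiag : len q₀ = 0 → z q₀ = 0 := fun h0 => by
    refine dist_le_zero.1 (ge_of_tendsto (tendsto_iff_dist_tendsto_zero.1 hY)
      (Eventually.of_forall fun i => ?_))
    refine le_trans (le_of_eq ?_) (dist_apply_le (yProc h𝓕 X α x i.1.1 i.1.2) z q₀)
    rw [yProc_apply, h0, zero_mul, zero_smul, dist_comm]
  set a : (ℕ × Ω) × Triangle → ℝ := fun i => len i.2 * α i.1.1 with ha
  have ha0 : ∀ᶠ i in (𝒰 : Filter ((ℕ × Ω) × Triangle)), 0 ≤ a i :=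
    (hαn.eventually_ge_atTop 0).mono fun i hi => mul_nonneg (len_nonneg _) hi
  set y : (ℕ × Ω) × Triangle → LInf 𝓕 := fun i => yHat h𝓕 X i.1.1 i.2 i.1.2 with hy
  have hYa : Tendsto (fun i => a i • (y i - x)) 𝒰 (𝓝 (z q₀)) := hYz
  suffices hgoal : Tendsto (fun i => a i • (φ (y i) - φ x)) 𝒰 (𝓝 (φ' (z q₀))) by
    have := hgoal.sub ((φ'.continuous.tendsto (z q₀)).comp hzq)
    rw [sub_self] at this
    exact this
  -- An empty sub-sample gives `ŷ = 0`, possibly outside `D`. This is harmless if `x = 0`, since `x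
  -- ∈ D`; otherwise `a • (0 - x) → 0` forces `a → 0`.
  by_cases hE : ∀ᶠ i in (𝒰 : Filter ((ℕ × Ω) × Triangle)),
      ⌊(i.1.1 : ℝ) * i.2.1.1⌋₊ < ⌊(i.1.1 : ℝ) * i.2.1.2⌋₊ ∨ x = 0
  swap
  · -- empty sub-samples
    rw [← Ultrafilter.eventually_not] at hE
    simp only [not_or, not_lt] at hE
    have hx : x ≠ 0 := hE.exists.choose_spec.2
    have hy0 : ∀ᶠ i in (𝒰 : Filter ((ℕ × Ω) × Triangle)), y i = 0 :=
      hE.mono fun i hi => yHat_eq_zero h𝓕 X _ hi.1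
    have hl0 : len q₀ = 0 := by
      refine tendsto_nhds_unique hlen ?_
      have hinv : Tendsto (fun i : (ℕ × Ω) × Triangle => ((i.1.1 : ℝ))⁻¹) 𝒰 (𝓝 0) :=
        (tendsto_inv_atTop_zero.comp tendsto_natCast_atTop_atTop).comp hn
      refine squeeze_zero' (Eventually.of_forall fun i => len_nonneg _) ?_ hinv
      filter_upwards [hE, hn.eventually_gt_atTop 0] with i hi hi0
      have hpos : (0 : ℝ) < i.1.1 := by exact_mod_cast hi0
      rw [← one_div, le_div_iff₀ hpos, mul_comm]
      exact mul_len_le_one hi.1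
    rw [hdiag hl0] at hYa ⊢
    have ha' : Tendsto a 𝒰 (𝓝 0) := by
      have h1 : Tendsto (fun i => ‖a i • (y i - x)‖ / ‖x‖) 𝒰 (𝓝 0) := by
        simpa using hYa.norm.div_const ‖x‖
      refine squeeze_zero_norm' ?_ h1
      filter_upwards [hy0] with i hi
      rw [hi, zero_sub, norm_smul, norm_neg, mul_div_cancel_right₀ _ (norm_ne_zero_iff.2 hx)]
    have h2 := ha'.smul_const (φ 0 - φ x)
    rw [zero_smul] at h2
    rw [map_zero]
    refine h2.congr' ?_
    filter_upwards [hy0] with i hi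
    rw [hi]
  have hyD : ∀ᶠ i in (𝒰 : Filter ((ℕ × Ω) × Triangle)), y i ∈ D := by
    filter_upwards [hE, hA, hqK] with i hi hiA hiK
    by_cases hlt : ⌊(i.1.1 : ℝ) * i.2.1.1⌋₊ < ⌊(i.1.1 : ℝ) * i.2.1.2⌋₊
    · exact hD _ _ hiA _ hiK hlt
    · have hx0 := hi.resolve_left hlt
      have : y i = x := (yHat_eq_zero h𝓕 X _ (not_lt.1 hlt)).trans hx0.symm
      rw [this]
      exact hC.1.1
  by_cases hatop : Tendsto a 𝒰 atTop
  · have hr : Tendsto (fun i => (a i)⁻¹) 𝒰 (𝓝[>] 0) := tendsto_inv_atTop_nhdsGT_zero.comp hatop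
    have hxy : ∀ᶠ i in (𝒰 : Filter ((ℕ × Ω) × Triangle)),
        x + (a i)⁻¹ • a i • (y i - x) = y i := by
      filter_upwards [hatop.eventually_gt_atTop 0] with i hi
      rw [inv_smul_smul₀ hi.ne']
      abel
    refine (hC.1.tendsto hr hYa (hzV q₀ hq₀) ?_).congr' ?_
    · filter_upwards [hxy, hyD] with i h1 h2
      rwa [h1]
    · filter_upwards [hxy] with i h1
      rw [h1, inv_inv]
  -- Along an ultrafilter, `a` not tending to infinity is eventually bounded, so `len ≤ B / α_n →
  -- 0`.
  · obtain ⟨B, hB⟩ : ∃ B, ∀ᶠ i in (𝒰 : Filter ((ℕ × Ω) × Triangle)), a i < B := by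
      rw [tendsto_atTop] at hatop
      push Not at hatop
      obtain ⟨B, hB⟩ := hatop
      exact ⟨B, hB⟩
    have hl0 : len q₀ = 0 := by
      refine tendsto_nhds_unique hlen ?_
      refine squeeze_zero' (Eventually.of_forall fun i => len_nonneg _) ?_ (hαn.const_div_atTop B)
      filter_upwards [hB, hαn.eventually_gt_atTop 0] with i hi hi0
      rw [le_div_iff₀ hi0]
      exact hi.le
    rw [hdiag hl0] at hYa ⊢
    rw [map_zero]
    by_cases hlow : ∃ δ : ℝ, 0 < δ ∧ ∀ᶠ i in (𝒰 : Filter ((ℕ × Ω) × Triangle)), δ < a i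
    · obtain ⟨δ, hδ, hδa⟩ := hlow
      have hyx : Tendsto y 𝒰 (𝓝 x) := by
        rw [tendsto_iff_norm_sub_tendsto_zero]
        have h1 : Tendsto (fun i => ‖a i • (y i - x)‖ / δ) 𝒰 (𝓝 0) := by
          simpa using hYa.norm.div_const δ
        refine squeeze_zero' (Eventually.of_forall fun _ => norm_nonneg _) ?_ h1
        filter_upwards [hδa, ha0] with i hi hi0
        rw [le_div_iff₀ hδ, norm_smul, mul_comm, Real.norm_of_nonneg hi0]
        gcongr
      have hφ : Tendsto (fun i => φ (y i)) 𝒰 (𝓝 (φ x)) :=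
        (hC.1.continuousWithinAt hC.2.1).tendsto.comp (tendsto_nhdsWithin_iff.2 ⟨hyx, hyD⟩)
      have hφ0 : Tendsto (fun i => B * ‖φ (y i) - φ x‖) 𝒰 (𝓝 0) := by
        simpa using (tendsto_iff_norm_sub_tendsto_zero.1 hφ).const_mul B
      refine squeeze_zero_norm' ?_ hφ0
      filter_upwards [hB, ha0] with i hi hi0
      rw [norm_smul, Real.norm_of_nonneg hi0]
      gcongr
    · push Not at hlow
      have ha' : ∀ δ : ℝ, 0 < δ → ∀ᶠ i in (𝒰 : Filter ((ℕ × Ω) × Triangle)), a i ≤ δ :=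
        hlow
      rw [Metric.tendsto_nhds]
      intro ε hε
      obtain ⟨δ, hδ, hev⟩ := hsmall (ε / 3) (by positivity)
      filter_upwards [ha' δ hδ, ha' (ε / 3 / (‖φ x‖ + 1)) (by positivity), ha0, hn.eventually hev,
        hA, hqK'] with i h1 h2 h3 h4 h5 h6
      have h7 := h4 _ h5 _ h6 (by rw [mul_comm]; exact h1)
      rw [mul_comm (α _)] at h7
      rw [le_div_iff₀ (by positivity)] at h2
      rw [dist_zero_right, norm_smul, Real.norm_of_nonneg h3]
      calc a i * ‖φ (y i) - φ x‖ ≤ a i * (‖φ (y i)‖ + ‖φ x‖) := by gcongr; exact norm_sub_le _ _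
        _ = a i * ‖φ (y i)‖ + a i * ‖φ x‖ := mul_add _ _ _
        _ ≤ ε / 3 + ε / 3 := add_le_add h7 (by linarith)
        _ < ε := by linarith

end Processes

/-! ### Continuity and measurability of the self-normalized statistic -/

section Normalizer

variable {ι : Type*} {l : Filter ι} {p : ℕ} {H : Measure Triangle} [IsProbabilityMeasure H]
  {K' : Set Triangle} {v : ι → Triangle → Fin p → ℝ} {v₀ : Triangle → Fin p → ℝ}

theorem tendsto_apply_of_tendsto_prod
    (hlim : Tendsto (fun i : ι × Triangle => v i.1 i.2 - v₀ i.2) (l ×ˢ 𝓟 K') (𝓝 0))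
    {q : Triangle} (hq : q ∈ K') : Tendsto (fun i => v i q) l (𝓝 (v₀ q)) := by
  have h1 : Tendsto (fun i => (i, q)) l (l ×ˢ 𝓟 K') :=
    tendsto_id.prodMk (tendsto_principal.2 (Eventually.of_forall fun _ => hq))
  exact tendsto_sub_nhds_zero_iff.1 (hlim.comp h1)

/-- Uniform convergence on `K'` provides the constant dominating function; countable generation of
`l` is what dominated convergence along a filter requires. -/
theorem tendsto_normalizer [l.IsCountablyGenerated] (hH : ∀ᵐ q ∂H, q ∈ K') (hfull : full ∈ K')
    (hv : ∀ᶠ i in l, AEMeasurable (v i) H) {B : ℝ} (hB : ∀ q ∈ K', ‖v₀ q‖ ≤ B)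
    (hlim : Tendsto (fun i : ι × Triangle => v i.1 i.2 - v₀ i.2) (l ×ˢ 𝓟 K') (𝓝 0)) :
    Tendsto (fun i => normalizer H (v i)) l (𝓝 (normalizer H v₀)) := by
  have hunif : ∀ᶠ i in l, ∀ q ∈ K', ‖v i q‖ ≤ B + 1 := by
    have h1 := hlim.eventually (Metric.ball_mem_nhds 0 one_pos)
    rw [eventually_prod_principal_iff] at h1
    filter_upwards [h1] with i hi q hq
    have h2 : dist (v i q - v₀ q) 0 < 1 := hi q hq
    rw [dist_zero_right] at h2
    have h3 := norm_add_le (v i q - v₀ q) (v₀ q)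
    rw [sub_add_cancel] at h3
    linarith [hB q hq]
  refine tendsto_pi_nhds.2 fun j => tendsto_pi_nhds.2 fun k => ?_
  refine tendsto_integral_filter_of_dominated_convergence
    (fun _ => (2 * (B + 1)) * (2 * (B + 1))) ?_ ?_ (integrable_const _) ?_
  · filter_upwards [hv] with i hi
    have hm : ∀ j, AEMeasurable (fun q => (v i q - len q • v i full) j) H := fun j =>
      (aemeasurable_pi_iff.1 (hi.sub (continuous_len.measurable.aemeasurable.smul_const _))) j
    exact ((hm j).mul (hm k)).aestronglyMeasurable
  · filter_upwards [hunif] with i hi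
    filter_upwards [hH] with q hq
    have hb : ∀ j, ‖(v i q - len q • v i full) j‖ ≤ 2 * (B + 1) := fun j => by
      refine (norm_le_pi_norm _ j).trans ((norm_sub_le _ _).trans ?_)
      rw [norm_smul, Real.norm_of_nonneg (len_nonneg q)]
      have h1 := mul_le_mul (len_le_one q) (hi _ hfull) (norm_nonneg _) zero_le_one
      linarith [hi _ hq]
    rw [norm_mul]
    exact mul_le_mul (hb j) (hb k) (norm_nonneg _) ((norm_nonneg _).trans (hb j))
  · filter_upwards [hH] with q hq
    have h1 := (tendsto_apply_of_tendsto_prod hlim hq).sub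
      ((tendsto_apply_of_tendsto_prod hlim hfull).const_smul (len q))
    exact (tendsto_pi_nhds.1 h1 j).mul (tendsto_pi_nhds.1 h1 k)

theorem tendsto_selfNormalized [l.IsCountablyGenerated] (hH : ∀ᵐ q ∂H, q ∈ K')
    (hfull : full ∈ K') (hv : ∀ᶠ i in l, AEMeasurable (v i) H) {B : ℝ}
    (hB : ∀ q ∈ K', ‖v₀ q‖ ≤ B)
    (hlim : Tendsto (fun i : ι × Triangle => v i.1 i.2 - v₀ i.2) (l ×ˢ 𝓟 K') (𝓝 0))
    (hdet : (normalizer H v₀).det ≠ 0) :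
    Tendsto (fun i => selfNormalized H (v i)) l (𝓝 (selfNormalized H v₀)) := by
  have hN := tendsto_normalizer hH hfull hv hB hlim
  have hf := tendsto_apply_of_tendsto_prod hlim hfull
  have hcont : ContinuousAt
      (fun u : (Fin p → ℝ) × Matrix (Fin p) (Fin p) ℝ => dotProduct u.1 (u.2⁻¹.mulVec u.1))
      (v₀ full, normalizer H v₀) := by
    have hinv : ContinuousAt (fun u : (Fin p → ℝ) × Matrix (Fin p) (Fin p) ℝ => u.2⁻¹)
        (v₀ full, normalizer H v₀) := by
      simp only [Matrix.inv_def, Ring.inverse_eq_inv']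
      have h1 : ContinuousAt (fun u : (Fin p → ℝ) × Matrix (Fin p) (Fin p) ℝ => (u.2.det)⁻¹)
          (v₀ full, normalizer H v₀) := continuous_snd.matrix_det.continuousAt.inv₀ hdet
      have h2 : Continuous (fun u : (Fin p → ℝ) × Matrix (Fin p) (Fin p) ℝ => u.2.adjugate) :=
        continuous_snd.matrix_adjugate
      exact h1.smul h2.continuousAt
    simp only [dotProduct, Matrix.mulVec]
    have hfst : ∀ j, ContinuousAt (fun u : (Fin p → ℝ) × Matrix (Fin p) (Fin p) ℝ => u.1 j)
        (v₀ full, normalizer H v₀) := fun j =>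
      ((continuous_apply j).comp continuous_fst).continuousAt
    refine tendsto_finsetSum _ fun j _ => (hfst j).mul (tendsto_finsetSum _ fun k _ => ?_)
    exact (tendsto_pi_nhds.1 (tendsto_pi_nhds.1 hinv j) k).mul (hfst k)
  exact hcont.tendsto.comp (hf.prodMk_nhds hN)

end Normalizer

/-- Apart from the factor `len q`, the path depends on `q` only through two integers, so no
measurability of `φ` is needed. -/
theorem measurable_smul_floor {p : ℕ} (G : ℕ → ℕ → Fin p → ℝ) (n : ℕ) (c : ℝ) :
    Measurable fun q : Triangle => (len q * c) • G ⌊(n : ℝ) * q.1.1⌋₊ ⌊(n : ℝ) * q.1.2⌋₊ := by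
  have hfl : Measurable fun q : Triangle => (⌊(n : ℝ) * q.1.1⌋₊, ⌊(n : ℝ) * q.1.2⌋₊) := by
    refine Measurable.prodMk (Nat.measurable_floor.comp ?_) (Nat.measurable_floor.comp ?_) <;>
      fun_prop
  have hG : Measurable fun m : ℕ × ℕ => G m.1 m.2 := Measurable.of_discrete
  exact (continuous_len.measurable.mul_const c).smul (hG.comp hfl)

theorem measurable_vProc {𝓧 Ω : Type*} {J p : ℕ} {𝓕 : Fin J → Set (𝓧 → ℝ)}
    (h𝓕 : FiniteEnvelope 𝓕) (X : ℕ → Ω → 𝓧) (α : ℕ → ℝ) (x : LInf 𝓕) (φ : LInf 𝓕 → Fin p → ℝ)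
    (n : ℕ) (ω : Ω) : Measurable (vProc h𝓕 X α x φ n ω) :=
  measurable_smul_floor (fun k m => φ (((m : ℝ) - (k : ℝ))⁻¹ •
    ∑ i ∈ Finset.Ioc k m, evalAt h𝓕 (X i ω)) - φ x) n (α n)

section Limit

variable {𝓧 : Type*} {J p : ℕ} {𝓕 : Fin J → Set (𝓧 → ℝ)} {K : Set Triangle}
  {H : Measure Triangle}

theorem isClosed_setOf_continuousOn (𝓕 : Fin J → Set (𝓧 → ℝ)) (K : Set Triangle) :
    IsClosed {y : PathSpace 𝓕 | ContinuousOn (fun q => y q) K} := by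
  refine isClosed_of_closure_subset fun y hy => ?_
  refine continuousOn_of_uniform_approx_of_continuousOn fun u hu => ?_
  obtain ⟨ε, hε, hεu⟩ := Metric.mem_uniformity_dist.1 hu
  obtain ⟨y', hy', hdist⟩ := Metric.mem_closure_iff.1 hy ε hε
  exact ⟨fun q => y' q, hy', fun q _ => hεu ((dist_apply_le y y' q).trans_lt hdist)⟩

theorem norm_map_apply_le (φ' : LInf 𝓕 →L[ℝ] (Fin p → ℝ)) (y : PathSpace 𝓕) (q : Triangle) :
    ‖φ' (y q)‖ ≤ ‖φ'‖ * ‖y‖ :=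
  (φ'.le_opNorm _).trans (mul_le_mul_of_nonneg_left
    (lp.norm_apply_le_norm ENNReal.top_ne_zero y q) (norm_nonneg _))

theorem tendsto_map_sub_nhds (φ' : LInf 𝓕 →L[ℝ] (Fin p → ℝ)) (K : Set Triangle)
    (y₀ : PathSpace 𝓕) :
    Tendsto (fun i : PathSpace 𝓕 × Triangle => φ' (i.1 i.2) - φ' (y₀ i.2)) (𝓝 y₀ ×ˢ 𝓟 K)
      (𝓝 0) := by
  have h1 : Tendsto (fun i : PathSpace 𝓕 × Triangle => ‖φ'‖ * dist i.1 y₀) (𝓝 y₀ ×ˢ 𝓟 K)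
      (𝓝 0) := by
    simpa using (tendsto_iff_dist_tendsto_zero.1
      (tendsto_fst (f := 𝓝 y₀) (g := 𝓟 K))).const_mul ‖φ'‖
  refine squeeze_zero_norm (fun i => ?_) h1
  rw [← map_sub]
  refine (φ'.le_opNorm _).trans (mul_le_mul_of_nonneg_left ?_ (norm_nonneg _))
  rw [← dist_eq_norm]
  exact dist_apply_le _ _ _

theorem aemeasurable_map_apply (hK : IsCompact K) (hH : ∀ᵐ q ∂H, q ∈ K)
    (φ' : LInf 𝓕 →L[ℝ] (Fin p → ℝ)) {y : PathSpace 𝓕} (hy : ContinuousOn (fun q => y q) K) :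
    AEMeasurable (fun q => φ' (y q)) H := by
  rw [← Measure.restrict_eq_self_of_ae_mem hH]
  exact (φ'.continuous.comp_continuousOn hy).aemeasurable hK.measurableSet

/-- The functional is continuous on the set `T` of paths that are continuous on `K` with nonsingular
normalizer. `T` is relatively open in a closed set, hence Borel, and almost every path of `Y` lies
in it. -/
theorem aemeasurable_selfNormalized_limit [IsProbabilityMeasure H] {Ω' : Type*}
    [MeasurableSpace Ω'] {P' : Measure Ω'} (hK : IsCompact K) (hH : ∀ᵐ q ∂H, q ∈ K) (hfull : full ∈ K)
    (φ' : LInf 𝓕 →L[ℝ] (Fin p → ℝ)) {Y : Ω' → PathSpace 𝓕}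
    (hY : @AEMeasurable Ω' (PathSpace 𝓕) (borel _) _ Y P')
    (hYc : ∀ᵐ ω' ∂P', ContinuousOn (fun q => Y ω' q) K)
    (hns : ∀ᵐ ω' ∂P', (normalizer H (fun q => φ' (Y ω' q))).det ≠ 0) :
    @AEMeasurable Ω' ℝ (borel ℝ) _
      (fun ω' => selfNormalized H (fun q => φ' (Y ω' q))) P' := by
  rw [← BorelSpace.measurable_eq (α := ℝ)]
  let _ : MeasurableSpace (PathSpace 𝓕) := borel _
  have : BorelSpace (PathSpace 𝓕) := ⟨rfl⟩
  have hY : AEMeasurable Y P' := hY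
  set S : Set (PathSpace 𝓕) := {y | ContinuousOn (fun q => y q) K} with hS
  have hSm : MeasurableSet S := (isClosed_setOf_continuousOn 𝓕 K).measurableSet
  have hlim : ∀ (T : Set (PathSpace 𝓕)) (y : PathSpace 𝓕),
      Tendsto (fun i : PathSpace 𝓕 × Triangle => φ' (i.1 i.2) - φ' (y i.2)) (𝓝[T] y ×ˢ 𝓟 K)
        (𝓝 0) := fun T y =>
    (tendsto_map_sub_nhds φ' K y).mono_left (Filter.prod_mono nhdsWithin_le_nhds le_rfl)
  have hmeas : ∀ T ⊆ S, ∀ y : PathSpace 𝓕, ∀ᶠ y' in 𝓝[T] y,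
      AEMeasurable (fun q => φ' (y' q)) H := fun T hT y =>
    eventually_nhdsWithin_of_forall fun y' hy' => aemeasurable_map_apply hK hH φ' (hT hy')
  have hdetc : ContinuousOn
      (fun y : PathSpace 𝓕 => (normalizer H (fun q => φ' (y q))).det) S := fun y _ =>
    (continuous_id.matrix_det.tendsto _).comp (tendsto_normalizer hH hfull (hmeas S subset_rfl y)
      (fun q _ => norm_map_apply_le φ' y q) (hlim S y))
  set T : Set (PathSpace 𝓕) := {y ∈ S | (normalizer H (fun q => φ' (y q))).det ≠ 0} with hT
  have hTm : MeasurableSet T := by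
    obtain ⟨U, hU, hUS⟩ := continuousOn_iff'.1 hdetc {0}ᶜ isOpen_compl_singleton
    have : T = U ∩ S := by
      rw [← hUS]
      ext y
      simp only [hT, Set.mem_inter_iff, Set.mem_preimage, Set.mem_compl_iff,
        Set.mem_singleton_iff]
      exact and_comm
    rw [this]
    exact hU.measurableSet.inter hSm
  have hgc : ContinuousOn (fun y : PathSpace 𝓕 => selfNormalized H (fun q => φ' (y q))) T :=
    fun y hy => tendsto_selfNormalized hH hfull (hmeas T (fun _ h => h.1) y)
      (fun q _ => norm_map_apply_le φ' y q) (hlim T y) hy.2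
  classical
  have hpw : Measurable (T.piecewise
      (fun y : PathSpace 𝓕 => selfNormalized H (fun q => φ' (y q))) fun _ => (0 : ℝ)) :=
    hgc.measurable_piecewise continuousOn_const hTm
  refine (hpw.comp_aemeasurable hY).congr ?_
  filter_upwards [hYc, hns] with ω' h1 h2
  exact Set.piecewise_eq_of_mem _ _ _ (show Y ω' ∈ T from ⟨h1, h2⟩)

end Limit

/-! ### Consequences of the assumptions (A1) and (A3) -/

/-- Having no modulus `δ` for a given tolerance lies in the event of (A1) for every `δ > 0`, hence
is a null event; countably many tolerances suffice. -/
theorem CondA1.ae_continuousOn {𝓧 Ω' : Type*} [MeasurableSpace Ω'] {J : ℕ}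
    {𝓕 : Fin J → Set (𝓧 → ℝ)} {P' : Measure Ω'} {Y : Ω' → PathSpace 𝓕} {K : Set Triangle}
    (hA1 : CondA1 P' Y K) : ∀ᵐ ω' ∂P', ContinuousOn (fun q => Y ω' q) K := by
  have key : ∀ m : ℕ, ∀ᵐ ω' ∂P', ∃ δ : ℝ, 0 < δ ∧ ∀ q ∈ K, ∀ q' ∈ K,
      |q.1.1 - q'.1.1| + |q.1.2 - q'.1.2| ≤ δ → ‖Y ω' q - Y ω' q'‖ ≤ 1 / ((m : ℝ) + 1) := by
    intro m
    refine le_antisymm (ge_of_tendsto (hA1 (1 / ((m : ℝ) + 1)) (by positivity)) ?_) (zero_le)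
    refine eventually_nhdsWithin_of_forall fun δ hδ => measure_mono fun ω' hω' => ?_
    simp only [Set.mem_compl_iff, Set.mem_ofPred_eq, not_exists, not_and, not_forall,
      not_le] at hω' ⊢
    obtain ⟨q, hq, q', hq', hd, hlt⟩ := hω' δ hδ
    exact ⟨q, hq, q', hq', hd, hlt⟩
  filter_upwards [ae_all_iff.2 key] with ω' hω'
  refine Metric.continuousOn_iff.2 fun q hq ε hε => ?_
  obtain ⟨m, hm⟩ := exists_nat_one_div_lt hε
  obtain ⟨δ, hδ, h⟩ := hω' m
  refine ⟨δ / 2, half_pos hδ, fun q' hq' hd => ?_⟩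
  rw [dist_eq_norm]
  refine (h q' hq' q hq ?_).trans_lt hm
  rw [Subtype.dist_eq, Prod.dist_eq, max_lt_iff, Real.dist_eq, Real.dist_eq] at hd
  linarith [hd.1, hd.2]

section CondA3

variable {𝓧 Ω : Type*} [MeasurableSpace Ω] {J p : ℕ} {𝓕 : Fin J → Set (𝓧 → ℝ)}
  {h𝓕 : FiniteEnvelope 𝓕} {X : ℕ → Ω → 𝓧} {P : Measure Ω} {α : ℕ → ℝ}
  {φ : LInf 𝓕 → Fin p → ℝ} {K : Set Triangle}

theorem CondA3.exists_eventually_measure_le (hA3 : CondA3 h𝓕 X P α φ K) {ε : ℝ} (hε : 0 < ε)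
    {η : ℝ≥0∞} (hη : 0 < η) :
    ∃ δ : ℝ, 0 < δ ∧ ∀ᶠ n in atTop, P {ω | ∃ q ∈ K, α n * len q ≤ δ ∧
      ε < α n * len q * ‖φ (yHat h𝓕 X n q ω)‖} ≤ η := by
  by_contra! hcon
  obtain ⟨ψ, hψ, hψη⟩ := extraction_forall_of_frequently fun m : ℕ =>
    (hcon (1 / ((m : ℝ) + 1)) (by positivity))
  -- If no `δ` works, the failures at `δ = 1 / (m + 1)` occur at indices `ψ m`; interpolating them
  -- by `0` gives one null sequence that contradicts (A3).
  set k : ℕ → ℝ := Function.extend ψ (fun m : ℕ => 1 / ((m : ℝ) + 1)) 0 with hk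
  have hkψ : ∀ m, k (ψ m) = 1 / ((m : ℝ) + 1) := hψ.injective.extend_apply _ _
  have hk0 : Tendsto k atTop (𝓝 0) := by
    rw [Metric.tendsto_atTop]
    intro r hr
    obtain ⟨M, hM⟩ := exists_nat_one_div_lt hr
    refine ⟨ψ M, fun n hn => ?_⟩
    by_cases hmem : ∃ m, ψ m = n
    · obtain ⟨m, rfl⟩ := hmem
      rw [hkψ, dist_zero_right, Real.norm_of_nonneg (by positivity)]
      exact (one_div_le_one_div_of_le (by positivity) (by
        have : M ≤ m := hψ.le_iff_le.1 hn
        have : (M : ℝ) ≤ m := by exact_mod_cast this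
        linarith)).trans_lt hM
    · rw [hk, Function.extend_apply' _ _ _ hmem]
      simpa using hr
  obtain ⟨m, hm⟩ := (((hA3 k hk0 ε hε).comp hψ.tendsto_atTop).eventually_lt_const hη).exists
  refine lt_asymm hm ?_
  simpa only [Function.comp_def, hkψ] using hψη m

/-- One event serves all tolerances `1 / (m + 1)`: the failure probabilities are chosen summable,
and level `m` is imposed only from `N m` on. -/
theorem CondA3.exists_small (hA3 : CondA3 h𝓕 X P α φ K) {η : ℝ≥0∞} (hη : 0 < η) :
    ∃ A : ℕ → Set Ω, (∀ n, P (A n)ᶜ ≤ η) ∧ ∀ ε : ℝ, 0 < ε → ∃ δ : ℝ, 0 < δ ∧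
      ∀ᶠ n in atTop, ∀ ω ∈ A n, ∀ q ∈ K,
        α n * len q ≤ δ → α n * len q * ‖φ (yHat h𝓕 X n q ω)‖ ≤ ε := by
  obtain ⟨η', hη', hsum⟩ := ENNReal.exists_pos_sum_of_countable hη.ne' ℕ
  have key := fun m : ℕ => hA3.exists_eventually_measure_le (ε := 1 / ((m : ℝ) + 1))
    (by positivity) (ENNReal.coe_pos.2 (hη' m))
  simp only [eventually_atTop] at key
  choose δ hδ N hN using key
  set bad : ℕ → ℕ → Set Ω := fun n m => {ω | ∃ q ∈ K, α n * len q ≤ δ m ∧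
    1 / ((m : ℝ) + 1) < α n * len q * ‖φ (yHat h𝓕 X n q ω)‖} with hbad
  refine ⟨fun n => {ω | ∀ m, N m ≤ n → ω ∉ bad n m}, fun n => ?_, fun ε hε => ?_⟩
  · have hsub : {ω | ∀ m, N m ≤ n → ω ∉ bad n m}ᶜ ⊆ ⋃ m, {ω | N m ≤ n ∧ ω ∈ bad n m} := by
      intro ω hω
      simp only [Set.mem_compl_iff, Set.mem_ofPred_eq, not_forall, not_not] at hω
      obtain ⟨m, h1, h2⟩ := hω
      exact Set.mem_iUnion.2 ⟨m, h1, h2⟩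
    refine (measure_mono hsub).trans ((measure_iUnion_le _).trans
      ((ENNReal.tsum_le_tsum fun m => ?_).trans hsum.le))
    by_cases hm : N m ≤ n
    · exact (measure_mono fun ω hω => hω.2).trans (hN m n hm)
    · simp [hm]
  · obtain ⟨m, hm⟩ := exists_nat_one_div_lt hε
    refine ⟨δ m, hδ m, eventually_atTop.2 ⟨N m, fun n hn ω hω q hq hle => ?_⟩⟩
    by_contra! hlt
    exact hω m hn ⟨q, hq, hle, hm.trans hlt⟩

end CondA3

end SubSample

/-! ### The weak limit of the self-normalized statistic -/

open SubSample in
theorem mainTheorem6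
    -- the data, the classes of functions and the limit point `x`
    {Ω 𝓧 : Type*} [MeasurableSpace Ω] (P : Measure Ω) [IsProbabilityMeasure P]
    (X : ℕ → Ω → 𝓧) {J : ℕ} {𝓕 : Fin J → Set (𝓧 → ℝ)} (h𝓕 : SubSample.FiniteEnvelope 𝓕)
    (α : ℕ → ℝ) (hα : Tendsto α atTop atTop) (x : SubSample.LInf 𝓕)
    -- the map `φ` with domain `D`; it has to be defined at the estimators
    {p : ℕ} (φ : SubSample.LInf 𝓕 → Fin p → ℝ) (D V : Set (SubSample.LInf 𝓕))
    (φ' : SubSample.LInf 𝓕 →L[ℝ] (Fin p → ℝ))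
    -- the probability measure `H` on `Δ` and a compact set that carries it and contains `(0,1)`
    (H : Measure SubSample.Triangle) [IsProbabilityMeasure H]
    (K : Set SubSample.Triangle) (hK : IsCompact K) (hHK : H.support ⊆ K)
    (hfull : SubSample.full ∈ K)
    (hD : ∀ n : ℕ, ∀ᵐ ω ∂P, ∀ q ∈ K, ⌊(n : ℝ) * q.1.1⌋₊ < ⌊(n : ℝ) * q.1.2⌋₊ →
      SubSample.yHat h𝓕 X n q ω ∈ D)
    -- the limiting process
    {Ω' : Type*} [MeasurableSpace Ω'] (P' : Measure Ω') [IsProbabilityMeasure P']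
    (Y : Ω' → SubSample.PathSpace 𝓕)
    (hC : SubSample.CondC φ D V φ' x)
    (hW : SubSample.CondW h𝓕 X P α x P' Y)
    (hA1 : SubSample.CondA1 P' Y K)
    (hA2 : SubSample.CondA2 P' Y V K)
    (hA3 : (∃ a : ℝ, 0 < a ∧ ∀ q ∈ H.support, a ≤ SubSample.len q) ∨
      SubSample.CondA3 h𝓕 X P α φ K)
    (hns : ∀ᵐ ω' ∂P', (SubSample.normalizer H (fun q => φ' (Y ω' q))).det ≠ 0) :
    SubSample.WeaklyConverges P
      (fun n ω => SubSample.selfNormalized H (SubSample.vProc h𝓕 X α x φ n ω))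
      P' (fun ω' => SubSample.selfNormalized H (fun q => φ' (Y ω' q))) := by
  have hsupp : ∀ᵐ q ∂H, q ∈ H.support := Measure.support_mem_ae
  have hH : ∀ᵐ q ∂H, q ∈ K := hsupp.mono fun q hq => hHK hq
  have hYc := hA1.ae_continuousOn
  -- it suffices to control `α n * len q * ‖φ (yHat h𝓕 X n q ω)‖` for small `α n * len q`
  suffices hsmall : ∃ K' ⊆ K, (∀ᵐ q ∂H, q ∈ K') ∧ full ∈ K' ∧ ∀ η : ℝ, 0 < η →
      ∃ A : ℕ → Set Ω, (∀ n, P (A n)ᶜ ≤ ENNReal.ofReal η) ∧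
        ∀ ε : ℝ, 0 < ε → ∃ δ : ℝ, 0 < δ ∧ ∀ᶠ n in atTop, ∀ ω ∈ A n, ∀ q ∈ K',
          α n * len q ≤ δ → α n * len q * ‖φ (yHat h𝓕 X n q ω)‖ ≤ ε by
    obtain ⟨K', hK', hHK', hfull', hsmall⟩ := hsmall
    refine hW.1.of_tendsto_approach (g := fun y => selfNormalized H (fun q => φ' (y q)))
      (aemeasurable_selfNormalized_limit hK hH hfull φ' hW.1.1 hYc hns) fun η hη => ?_
    obtain ⟨A, hA, hAsmall⟩ := hsmall η hη
    set G : ℕ → Set Ω := fun n => {ω | ∀ q ∈ K,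
      ⌊(n : ℝ) * q.1.1⌋₊ < ⌊(n : ℝ) * q.1.2⌋₊ → yHat h𝓕 X n q ω ∈ D} with hG
    refine ⟨fun n => A n ∩ G n, Eventually.of_forall fun n => ?_, ?_⟩
    · refine ENNReal.toReal_le_of_le_ofReal hη.le ?_
      rw [Set.compl_inter]
      refine (measure_union_le _ _).trans ?_
      have h0 : P (G n)ᶜ = 0 := hD n
      rw [h0, add_zero]
      exact hA n
    · filter_upwards [hYc, hA2, hns] with ω' h1 h2 h3
      have : (approach (yProc h𝓕 X α x) (fun n => A n ∩ G n) (Y ω')).IsCountablyGenerated := by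
        unfold approach
        infer_instance
      refine tendsto_selfNormalized (v := fun i : ℕ × Ω => vProc h𝓕 X α x φ i.1 i.2) hHK' hfull'
        (Eventually.of_forall fun i => (measurable_vProc h𝓕 X α x φ i.1 i.2).aemeasurable)
        (fun q _ => norm_map_apply_le φ' (Y ω') q) ?_ h3
      refine tendsto_vProc_sub hα hC hK hK' (fun n ω hω => hω.2) (fun ε hε => ?_) h1 h2
      obtain ⟨δ, hδ, hev⟩ := hAsmall ε hε
      exact ⟨δ, hδ, hev.mono fun n hn ω hω => hn ω hω.1⟩
  rcases hA3 with ⟨a, ha, haH⟩ | hA3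
  -- The minimum with `1` keeps `full`, of length `1`, in `K'`. There `α n * len q > 1` eventually,
  -- so the smallness condition with `δ = 1` is vacuous.
  · refine ⟨{q ∈ K | min a 1 ≤ len q}, fun q hq => hq.1, ?_, ⟨hfull, ?_⟩, fun η hη => ?_⟩
    · exact hsupp.mono fun q hq => ⟨hHK hq, (min_le_left _ _).trans (haH q hq)⟩
    · rw [len_full]
      exact min_le_right _ _
    · refine ⟨fun _ => Set.univ, fun n => by simp, fun ε hε => ⟨1, one_pos, ?_⟩⟩
      have hmin : 0 < min a 1 := lt_min ha one_pos
      filter_upwards [hα.eventually_gt_atTop (1 / min a 1), hα.eventually_gt_atTop 0]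
        with n hn hn0 ω _ q hq hle
      rw [div_lt_iff₀ hmin] at hn
      have := mul_le_mul_of_nonneg_left hq.2 hn0.le
      linarith
  · refine ⟨K, subset_rfl, hH, hfull, fun η hη => ?_⟩
    exact hA3.exists_small (ENNReal.ofReal_pos.2 hη)
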